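/- For vectors $s_1,\dots,s_k\in\mathbb{R}^2$ let $\mathrm{cone}(s_1,\dots,s_k)=\{\sum_j\lambda_j s_j\mid \lambda_j\ge 0\}$. Let $T=\{\mathrm{diag}(g_1,g_2,g_3)\mid g_j\in S^1,\ g_1g_2g_3=1\}\subset SU(3)$, and let $T\times T$ act on $SU(3)$ by $(g,h)\cdot A=gAh^{-1}$. Let $$M=\Bigl\{(z,w)\in\mathbb{C}^3\times\mathbb{C}^3 \Bigm| z\neq 0,\ w\neq 0,\ \sum_{j=1}^3 z_jw_j=0\Bigr\},$$ with the $T\times T$-action $(g,h)\cdot(z,w)=\bigl((g_jh_1^{-1}z_j)_{j},\,(g_j^{-1}h_3w_j)_{j}\bigr)$. Let $A_1,A_2,A_3,B_1,B_2,B_3,C\in\mathbb{R}^2$ satisfy $A_1+B_1=A_2+B_2=A_3+B_3$, and let $$\Phi\colon M\to\mathbb{R}^2,\qquad \Phi(z,w)=\sum_{j=1}^3\bigl(A_j|z_j|^2+B_j|w_j|^2\bigr).$$ **Theorem.** Assume the condition $(\star)$ $C\notin\mathrm{cone}(A_i,A_j)$, $C\notin\mathrm{cone}(B_i,B_j)$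 and $C\in\mathrm{cone}(A_i,B_j)$ for all $i,j\in\{1,2,3\}$. Then $C$ is a regular value of $\Phi$ (so that $\Phi^{-1}(C)$ is a smooth submanifold of $\mathbb{C}^3\times\mathbb{C}^3$), the set $\Phi^{-1}(C)$ is $T\times T$-invariant, and $\Phi^{-1}(C)$ is $T\times T$-equivariantly diffeomorphic to $SU(3)$. -/

import Mathlib

open scoped ContDiff

/-- The maximal torus `T = {(g₁, g₂, g₃) ∈ (S¹)³ | g₁ g₂ g₃ = 1}` of `SU(3)`; the triple `g` is
identified with the matrix `diag(g₁, g₂, g₃)`, see `torusMatrix`. -/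
def Torus : Subgroup (Fin 3 → Circle) where
  carrier := {g | g 0 * g 1 * g 2 = 1}
  one_mem' := by simp
  mul_mem' := by
    intro a b ha hb
    simp only [Set.mem_ofPred_eq, Pi.mul_apply] at *
    calc a 0 * b 0 * (a 1 * b 1) * (a 2 * b 2)
        = (a 0 * a 1 * a 2) * (b 0 * b 1 * b 2) := by ac_rfl
      _ = 1 := by rw [ha, hb, one_mul]
  inv_mem' := by
    intro a ha
    simp only [Set.mem_ofPred_eq, Pi.inv_apply] at *
    rw [← mul_inv, ← mul_inv, ha, inv_one]

/-- The diagonal matrix `diag(g₁, g₂, g₃)` of an element of `T`. -/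
def torusMatrix (g : Torus) : Matrix (Fin 3) (Fin 3) ℂ :=
  Matrix.diagonal fun j => ((g : Fin 3 → Circle) j : ℂ)

theorem torusMatrix_one : torusMatrix 1 = 1 := by
  ext i j
  simp [torusMatrix, Matrix.diagonal, Matrix.one_apply]

theorem torusMatrix_mul (g h : Torus) : torusMatrix (g * h) = torusMatrix g * torusMatrix h := by
  simp [torusMatrix, Matrix.diagonal_mul_diagonal]

/-- Elements of `T`, viewed as diagonal matrices, lie in `SU(3)`. -/
theorem torusMatrix_mem (g : Torus) :
    torusMatrix g ∈ Matrix.specialUnitaryGroup (Fin 3) ℂ := by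
  rw [Matrix.mem_specialUnitaryGroup_iff]
  constructor
  · rw [Matrix.mem_unitaryGroup_iff, Matrix.star_eq_conjTranspose, torusMatrix,
      Matrix.diagonal_conjTranspose, Matrix.diagonal_mul_diagonal]
    ext i j
    simp [Matrix.diagonal, Matrix.one_apply, Complex.mul_conj]
  · have h := g.2
    have h' : ((g : Fin 3 → Circle) 0 * (g : Fin 3 → Circle) 1 * (g : Fin 3 → Circle) 2
        : Circle) = 1 := h
    have h2 := congrArg (fun c : Circle => (c : ℂ)) h'
    simpa [torusMatrix, Matrix.det_diagonal, Fin.prod_univ_three] using h2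

/-- The action of `T × T` on `3 × 3` matrices (in particular on `SU(3)`):
`(g, h) • A = g A h⁻¹`. -/
noncomputable instance instMulActionMatrix :
    MulAction (Torus × Torus) (Matrix (Fin 3) (Fin 3) ℂ) where
  smul t A := torusMatrix t.1 * A * torusMatrix (t.2⁻¹)
  one_smul A := by
    change torusMatrix 1 * A * torusMatrix (1⁻¹) = A
    rw [inv_one, torusMatrix_one, one_mul, mul_one]
  mul_smul s t A := by
    change torusMatrix (s.1 * t.1) * A * torusMatrix ((s.2 * t.2)⁻¹)
      = torusMatrix s.1 * (torusMatrix t.1 * A * torusMatrix (t.2⁻¹)) * torusMatrix (s.2⁻¹)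
    rw [mul_inv_rev, torusMatrix_mul, torusMatrix_mul]
    simp only [mul_assoc]

/-- The space `ℂ³ × ℂ³` of pairs `(z, w)`. -/
abbrev C3C3 : Type := (Fin 3 → ℂ) × (Fin 3 → ℂ)

/-- The action of `T × T` on `ℂ³ × ℂ³`:
`(g, h) • (z, w) = ((g_j h₁⁻¹ z_j)_j, (g_j⁻¹ h₃ w_j)_j)`. -/
noncomputable instance instMulActionC3C3 : MulAction (Torus × Torus) C3C3 where
  smul t p :=
    (fun j => (((t.1 : Fin 3 → Circle) j : ℂ) * ((t.2 : Fin 3 → Circle) 0 : ℂ)⁻¹) * p.1 j,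
      fun j => (((t.1 : Fin 3 → Circle) j : ℂ)⁻¹ * ((t.2 : Fin 3 → Circle) 2 : ℂ)) * p.2 j)
  one_smul p := by
    refine Prod.ext (funext fun j => ?_) (funext fun j => ?_)
    · change (((1 : Circle) : ℂ) * ((1 : Circle) : ℂ)⁻¹) * p.1 j = p.1 j
      simp
    · change (((1 : Circle) : ℂ)⁻¹ * ((1 : Circle) : ℂ)) * p.2 j = p.2 j
      simp
  mul_smul s t p := by
    refine Prod.ext (funext fun j => ?_) (funext fun j => ?_)
    · change ((((s.1 : Fin 3 → Circle) j * (t.1 : Fin 3 → Circle) j : Circle) : ℂ)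
        * (((s.2 : Fin 3 → Circle) 0 * (t.2 : Fin 3 → Circle) 0 : Circle) : ℂ)⁻¹) * p.1 j
        = (((s.1 : Fin 3 → Circle) j : ℂ) * ((s.2 : Fin 3 → Circle) 0 : ℂ)⁻¹)
          * ((((t.1 : Fin 3 → Circle) j : ℂ) * ((t.2 : Fin 3 → Circle) 0 : ℂ)⁻¹) * p.1 j)
      rw [Circle.coe_mul, Circle.coe_mul, mul_inv]
      ring
    · change ((((s.1 : Fin 3 → Circle) j * (t.1 : Fin 3 → Circle) j : Circle) : ℂ)⁻¹
        * (((s.2 : Fin 3 → Circle) 2 * (t.2 : Fin 3 → Circle) 2 : Circle) : ℂ)) * p.2 j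
        = (((s.1 : Fin 3 → Circle) j : ℂ)⁻¹ * ((s.2 : Fin 3 → Circle) 2 : ℂ))
          * ((((t.1 : Fin 3 → Circle) j : ℂ)⁻¹ * ((t.2 : Fin 3 → Circle) 2 : ℂ)) * p.2 j)
      rw [Circle.coe_mul, Circle.coe_mul, mul_inv]
      ring

/-- The quadratic form `∑ z_j w_j`. -/
def quadric (p : C3C3) : ℂ := ∑ j, p.1 j * p.2 j

/-- `M = {(z, w) | z ≠ 0, w ≠ 0, ∑ z_j w_j = 0}`. -/
def quadricM : Set C3C3 := {p | p.1 ≠ 0 ∧ p.2 ≠ 0 ∧ quadric p = 0}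

/-- `Φ(z, w) = ∑ (A_j |z_j|² + B_j |w_j|²)`. -/
noncomputable def momentPhi (A B : Fin 3 → Fin 2 → ℝ) (p : C3C3) : Fin 2 → ℝ :=
  ∑ j, (‖p.1 j‖ ^ 2 • A j + ‖p.2 j‖ ^ 2 • B j)

/-- The level set `Φ⁻¹(C)` of `Φ : M → ℝ²`. -/
def levelSet (A B : Fin 3 → Fin 2 → ℝ) (C : Fin 2 → ℝ) : Set C3C3 :=
  {p | p ∈ quadricM ∧ momentPhi A B p = C}

/-- `C` is a regular value of `Φ : M → ℝ²`: at each point `p` of the level set, `dΦ_p` maps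
`T_p M = ker d(∑ z_j w_j)_p` onto `ℝ²`. -/
def IsRegularValuePhi (A B : Fin 3 → Fin 2 → ℝ) (C : Fin 2 → ℝ) : Prop :=
  ∀ p ∈ levelSet A B C, ∀ c : Fin 2 → ℝ, ∃ v : C3C3,
    fderiv ℝ quadric p v = 0 ∧ fderiv ℝ (momentPhi A B) p v = c

/-- The cone spanned by `s₁, …, s_k` in `ℝ²`. -/
def cone {k : ℕ} (s : Fin k → Fin 2 → ℝ) : Set (Fin 2 → ℝ) :=
  {x | ∃ l : Fin k → ℝ, (∀ j, 0 ≤ l j) ∧ x = ∑ j, l j • s j}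

/-- Condition `(⋆)`. -/
def StarCondition (A B : Fin 3 → Fin 2 → ℝ) (C : Fin 2 → ℝ) : Prop :=
  (∀ i j, C ∉ cone ![A i, A j] ∧ C ∉ cone ![B i, B j]) ∧ ∀ i j, C ∈ cone ![A i, B j]

/-- Smoothness of a map from a subset `X` of a normed space: near each point of `X` the map is
the restriction of a smooth map on an open subset of the ambient space. -/
def SmoothOnSubset {E F : Type*} [NormedAddCommGroup E] [NormedSpace ℝ E]
    [NormedAddCommGroup F] [NormedSpace ℝ F] (X : Set E) (f : X → F) : Prop :=
  ∀ x : X, ∃ (U : Set E) (f' : E → F), IsOpen U ∧ (x : E) ∈ U ∧ ContDiffOn ℝ ∞ f' U ∧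
    ∀ y : X, (y : E) ∈ U → f' y = f y

/-- Subsets `X ⊆ E` and `Y ⊆ F` are `G`-equivariantly diffeomorphic: `X` is `G`-invariant and
there is a bijection `X → Y`, smooth with smooth inverse, that commutes with `G` (so that `Y` is
`G`-invariant as well). -/
def EquivariantlyDiffeomorphic (G : Type*) [Group G] {E F : Type*}
    [NormedAddCommGroup E] [NormedSpace ℝ E] [NormedAddCommGroup F] [NormedSpace ℝ F]
    [MulAction G E] [MulAction G F] (X : Set E) (Y : Set F) : Prop :=
  ∃ (hX : ∀ (g : G), ∀ x ∈ X, g • x ∈ X) (f : X ≃ Y),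
    SmoothOnSubset X (fun x => (f x : F)) ∧
    SmoothOnSubset Y (fun y => (f.symm y : E)) ∧
    ∀ (g : G) (x : X), (f ⟨g • (x : E), hX g x x.2⟩ : F) = g • (f x : F)

/-- `SU(3)` as a subset of the space of complex `3 × 3` matrices. -/
def SU3 : Set (Matrix (Fin 3) (Fin 3) ℂ) := {A | A ∈ Matrix.specialUnitaryGroup (Fin 3) ℂ}

-- All norms on the space of matrices are equivalent; the entrywise sup norm is used.
attribute [local instance] Matrix.normedAddCommGroup Matrix.normedSpace

/-! Fix `(z, w)` with `z ≠ 0`, `w ≠ 0` and put `X = ∑ |z_j|² A_j`, `Y = ∑ |w_j|² B_j`, so that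
`Φ(s z, t w) = s² X + t² Y` for real `s`, `t`. Condition `(⋆)` says that the areas `det (A_i, B_j)`,
`det (C, B_j)` and `det (A_i, C)` are all nonzero with one common sign (`StarCondition.commonSign`).
By bilinearity `det (X, Y)`, `det (C, Y)`, `det (X, C)` have this sign too, so by Cramer's rule
`C = s² X + t² Y` has exactly one solution with `s, t > 0`, and it depends smoothly on `(z, w)`.
Thus `Φ⁻¹(C)` meets every orbit of the rescaling action of `(ℝ_{>0})²` on `M` exactly once, and
`rescale` is the smooth, `T × T`-equivariant projection of `M` onto it along the orbits. Two such
level sets are identified by projecting each onto the other. For `A_j = (1, 0)`, `B_j = (0, 1)`,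
`C = (1, 1)` the level set is `{|z| = |w| = 1, ∑ z_j w_j = 0}`, which is `SU(3)`: the vectors `z` and
`conj w` are the first and the third column of a matrix in `SU(3)`, and they determine the second
column (`frameMatrix`).

Regularity comes from the same orbits: the tangent vectors `(s z, t w)` are mapped by `dΦ` to
`2 s X + 2 t Y`, and `X`, `Y` span `ℝ²`. -/

open scoped ComplexConjugate

/-! ### Oriented areas and the sign condition -/

/-- The determinant of a pair of vectors in `ℝ²`. -/
def area (u v : Fin 2 → ℝ) : ℝ := u 0 * v 1 - u 1 * v 0

/-- The areas `det (A_i, B_j)`, `det (C, B_j)` and `det (A_i, C)` are nonzero and have one common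
sign, the sign of `ε`. -/
def CommonSign (A B : Fin 3 → Fin 2 → ℝ) (C : Fin 2 → ℝ) : Prop :=
  ∃ ε : ℝ, (∀ i j, 0 < ε * area (A i) (B j)) ∧ (∀ j, 0 < ε * area C (B j)) ∧
    ∀ i, 0 < ε * area (A i) C

theorem smul_mem_cone_pair (a : Fin 2 → ℝ) {r : ℝ} (hr : 0 ≤ r) : r • a ∈ cone ![a, a] :=
  ⟨![r, 0], by simp [Fin.forall_fin_two, hr], by simp⟩

theorem exists_pos_combination {a b c : Fin 2 → ℝ} (ha : c ∉ cone ![a, a])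
    (hb : c ∉ cone ![b, b]) (hc : c ∈ cone ![a, b]) :
    ∃ p q : ℝ, 0 < p ∧ 0 < q ∧ c = p • a + q • b := by
  obtain ⟨l, hl, rfl⟩ := hc
  simp only [Fin.sum_univ_two, Matrix.cons_val_zero, Matrix.cons_val_one] at ha hb ⊢
  refine ⟨l 0, l 1, (hl 0).lt_of_ne' fun h => ?_, (hl 1).lt_of_ne' fun h => ?_, rfl⟩
  · exact hb (by simpa [h] using smul_mem_cone_pair b (hl 1))
  · exact ha (by simpa [h] using smul_mem_cone_pair a (hl 0))

theorem area_ne_zero_of_mem_cone {a b c : Fin 2 → ℝ} (ha : c ∉ cone ![a, a])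
    (hb : c ∉ cone ![b, b]) (hc : c ∈ cone ![a, b]) : area a b ≠ 0 := by
  obtain ⟨p, q, hp, hq, rfl⟩ := exists_pos_combination ha hb hc
  intro h
  have ha0 : a ≠ 0 := by
    rintro rfl
    exact hb (by simpa using smul_mem_cone_pair b hq.le)
  obtain ⟨r, rfl⟩ : ∃ r : ℝ, b = r • a := by
    rw [area, sub_eq_zero] at h
    by_cases h0 : a 0 = 0
    · have h1 : a 1 ≠ 0 := fun h1 => ha0 (by ext i; fin_cases i <;> simp [h0, h1])
      refine ⟨b 1 / a 1, ?_⟩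
      have hb0 : b 0 = 0 := by simpa [h0, h1] using h.symm
      ext i; fin_cases i <;> simp [h0, h1, hb0]
    · refine ⟨b 0 / a 0, ?_⟩
      ext i; fin_cases i
      · simp [h0]
      · simp only [Fin.mk_one, Pi.smul_apply, smul_eq_mul]
        field_simp
        linarith
  -- Both vectors lie on one line; `c` is on the ray of `a` or on the opposite ray, that of `b`.
  rcases le_or_gt 0 (p + q * r) with h0 | h0
  · exact ha (by simpa [add_smul, mul_smul] using smul_mem_cone_pair a h0)
  · have hr : r < 0 := by nlinarith
    have key := smul_mem_cone_pair (r • a) (div_nonneg_of_nonpos h0.le hr.le)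
    rw [← mul_smul, div_mul_cancel₀ _ hr.ne, add_smul, mul_smul] at key
    exact hb key

theorem StarCondition.commonSign {A B : Fin 3 → Fin 2 → ℝ} {C : Fin 2 → ℝ}
    (h : StarCondition A B C) : CommonSign A B C := by
  have hne : ∀ i j, area (A i) (B j) ≠ 0 := fun i j =>
    area_ne_zero_of_mem_cone (h.1 i i).1 (h.1 j j).2 (h.2 i j)
  -- `det (C, B_j)` and `det (A_i, C)` are positive multiples of `det (A_i, B_j)`, for all `i`, `j`.
  have hB : ∀ i j, ∃ p > 0, area C (B j) = p * area (A i) (B j) := fun i j => by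
    obtain ⟨p, q, hp, -, rfl⟩ := exists_pos_combination (h.1 i i).1 (h.1 j j).2 (h.2 i j)
    exact ⟨p, hp, by simp [area]; ring⟩
  have hA : ∀ i j, ∃ q > 0, area (A i) C = q * area (A i) (B j) := fun i j => by
    obtain ⟨p, q, -, hq, rfl⟩ := exists_pos_combination (h.1 i i).1 (h.1 j j).2 (h.2 i j)
    exact ⟨q, hq, by simp [area]; ring⟩
  have hBpos : ∀ j, 0 < area (A 0) C * area C (B j) := fun j => by
    obtain ⟨p, hp, hp'⟩ := hB 0 j
    obtain ⟨q, hq, hq'⟩ := hA 0 j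
    have := mul_pos (mul_pos hp hq) (mul_self_pos.2 (hne 0 j))
    rw [hp', hq']
    linarith
  have hABpos : ∀ i j, 0 < area (A 0) C * area (A i) (B j) := fun i j => by
    obtain ⟨p, hp, hp'⟩ := hB i j
    have := hBpos j
    rw [hp', mul_left_comm] at this
    exact pos_of_mul_pos_right this hp.le
  refine ⟨area (A 0) C, hABpos, hBpos, fun i => ?_⟩
  obtain ⟨q, hq, hq'⟩ := hA i 0
  rw [hq', mul_left_comm]
  exact mul_pos hq (hABpos i 0)

/-! ### Weighted sums -/

/-- The vector `∑ |z_j|² A_j`. -/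
noncomputable def weightedSum (A : Fin 3 → Fin 2 → ℝ) (z : Fin 3 → ℂ) : Fin 2 → ℝ :=
  ∑ j, ‖z j‖ ^ 2 • A j

theorem momentPhi_eq (A B : Fin 3 → Fin 2 → ℝ) (p : C3C3) :
    momentPhi A B p = weightedSum A p.1 + weightedSum B p.2 :=
  Finset.sum_add_distrib

theorem weightedSum_smul (A : Fin 3 → Fin 2 → ℝ) (r : ℝ) (z : Fin 3 → ℂ) :
    weightedSum A (r • z) = r ^ 2 • weightedSum A z := by
  simp [weightedSum, Finset.smul_sum, mul_pow, mul_smul]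

theorem contDiff_weightedSum (A : Fin 3 → Fin 2 → ℝ) : ContDiff ℝ ∞ (weightedSum A) := by
  unfold weightedSum
  exact ContDiff.sum fun j _ =>
    ((contDiff_norm_sq ℝ).comp (contDiff_apply ℝ ℂ j)).smul contDiff_const

theorem sum_norm_sq_mul_pos {f : Fin 3 → ℝ} (hf : ∀ j, 0 < f j) {z : Fin 3 → ℂ} (hz : z ≠ 0) :
    0 < ∑ j, ‖z j‖ ^ 2 * f j := by
  obtain ⟨j, hj⟩ := Function.ne_iff.1 hz
  exact Finset.sum_pos' (fun i _ => mul_nonneg (sq_nonneg _) (hf i).le)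
    ⟨j, Finset.mem_univ _, mul_pos (pow_pos (norm_pos_iff.2 hj) 2) (hf j)⟩

theorem mul_area_weightedSum_left_pos {A : Fin 3 → Fin 2 → ℝ} {v : Fin 2 → ℝ} {ε : ℝ}
    (h : ∀ i, 0 < ε * area (A i) v) {z : Fin 3 → ℂ} (hz : z ≠ 0) :
    0 < ε * area (weightedSum A z) v := by
  convert sum_norm_sq_mul_pos h hz using 1
  simp [weightedSum, area, Fin.sum_univ_three]
  ring

theorem mul_area_weightedSum_right_pos {B : Fin 3 → Fin 2 → ℝ} {u : Fin 2 → ℝ} {ε : ℝ}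
    (h : ∀ j, 0 < ε * area u (B j)) {w : Fin 3 → ℂ} (hw : w ≠ 0) :
    0 < ε * area u (weightedSum B w) := by
  convert sum_norm_sq_mul_pos h hw using 1
  simp [weightedSum, area, Fin.sum_univ_three]
  ring

/-! ### Rescaling onto the level set -/

/-- The value of `s²` in the solution of `s² X + t² Y = C` by Cramer's rule, where
`X = ∑ |z_j|² A_j` and `Y = ∑ |w_j|² B_j`. -/
noncomputable def scaleSqFst (A B : Fin 3 → Fin 2 → ℝ) (C : Fin 2 → ℝ) (p : C3C3) : ℝ :=
  area C (weightedSum B p.2) / area (weightedSum A p.1) (weightedSum B p.2)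

/-- The value of `t²` in the solution of `s² X + t² Y = C` by Cramer's rule, where
`X = ∑ |z_j|² A_j` and `Y = ∑ |w_j|² B_j`. -/
noncomputable def scaleSqSnd (A B : Fin 3 → Fin 2 → ℝ) (C : Fin 2 → ℝ) (p : C3C3) : ℝ :=
  area (weightedSum A p.1) C / area (weightedSum A p.1) (weightedSum B p.2)

/-- The point `(s z, t w)`, `s, t > 0`, with `Φ(s z, t w) = C`. It is meaningful on the set of
`(z, w)` with `z ≠ 0` and `w ≠ 0`. -/
noncomputable def rescale (A B : Fin 3 → Fin 2 → ℝ) (C : Fin 2 → ℝ) (p : C3C3) : C3C3 :=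
  (√(scaleSqFst A B C p) • p.1, √(scaleSqSnd A B C p) • p.2)

/-- The open set of pairs `(z, w)` with `z ≠ 0` and `w ≠ 0`. -/
def nonzeroPairs : Set C3C3 := {p | p.1 ≠ 0 ∧ p.2 ≠ 0}

theorem isOpen_nonzeroPairs : IsOpen nonzeroPairs :=
  (isOpen_ne_fun continuous_fst continuous_const).inter
    (isOpen_ne_fun continuous_snd continuous_const)

theorem levelSet_subset_nonzeroPairs (A B : Fin 3 → Fin 2 → ℝ) (C : Fin 2 → ℝ) :
    levelSet A B C ⊆ nonzeroPairs :=
  fun _ hp => ⟨hp.1.1, hp.1.2.1⟩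

theorem quadric_smul (s t : ℝ) (p : C3C3) :
    quadric (s • p.1, t • p.2) = (s * t : ℝ) * quadric p := by
  simp [quadric, Finset.mul_sum]
  refine Finset.sum_congr rfl fun j _ => ?_
  ring

theorem smul_mem_quadricM {p : C3C3} (hp : p ∈ quadricM) {s t : ℝ} (hs : s ≠ 0) (ht : t ≠ 0) :
    ((s • p.1, t • p.2) : C3C3) ∈ quadricM :=
  ⟨smul_ne_zero hs hp.1, smul_ne_zero ht hp.2.1, by rw [quadric_smul, hp.2.2, mul_zero]⟩

theorem momentPhi_smul (A B : Fin 3 → Fin 2 → ℝ) (s t : ℝ) (p : C3C3) :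
    momentPhi A B (s • p.1, t • p.2) = s ^ 2 • weightedSum A p.1 + t ^ 2 • weightedSum B p.2 := by
  rw [momentPhi_eq, weightedSum_smul, weightedSum_smul]

/-- Cramer's rule in the plane. -/
theorem cramer_plane {X Y : Fin 2 → ℝ} (h : area X Y ≠ 0) (c : Fin 2 → ℝ) :
    (area c Y / area X Y) • X + (area X c / area X Y) • Y = c := by
  ext i
  simp only [Pi.add_apply, Pi.smul_apply, smul_eq_mul]
  rw [div_mul_eq_mul_div, div_mul_eq_mul_div, ← add_div, div_eq_iff h]
  fin_cases i <;> simp [area] <;> ring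

namespace CommonSign

variable {A B : Fin 3 → Fin 2 → ℝ} {C : Fin 2 → ℝ} {p : C3C3}

theorem area_ne_zero (h : CommonSign A B C) (hp : p ∈ nonzeroPairs) :
    area (weightedSum A p.1) (weightedSum B p.2) ≠ 0 := by
  obtain ⟨ε, h1, -, -⟩ := h
  exact right_ne_zero_of_mul (mul_area_weightedSum_left_pos
    (fun i => mul_area_weightedSum_right_pos (h1 i) hp.2) hp.1).ne'

theorem scaleSqFst_pos (h : CommonSign A B C) (hp : p ∈ nonzeroPairs) :
    0 < scaleSqFst A B C p := by
  obtain ⟨ε, h1, h2, -⟩ := h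
  have hd := mul_area_weightedSum_left_pos
    (fun i => mul_area_weightedSum_right_pos (h1 i) hp.2) hp.1
  rw [scaleSqFst, ← mul_div_mul_left _ _ (left_ne_zero_of_mul hd.ne')]
  exact div_pos (mul_area_weightedSum_right_pos h2 hp.2) hd

theorem scaleSqSnd_pos (h : CommonSign A B C) (hp : p ∈ nonzeroPairs) :
    0 < scaleSqSnd A B C p := by
  obtain ⟨ε, h1, -, h3⟩ := h
  have hd := mul_area_weightedSum_left_pos
    (fun i => mul_area_weightedSum_right_pos (h1 i) hp.2) hp.1
  rw [scaleSqSnd, ← mul_div_mul_left _ _ (left_ne_zero_of_mul hd.ne')]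
  exact div_pos (mul_area_weightedSum_left_pos h3 hp.1) hd

theorem contDiffOn_rescale (h : CommonSign A B C) :
    ContDiffOn ℝ ∞ (rescale A B C) nonzeroPairs := by
  have hX : ∀ i, ContDiffOn ℝ ∞ (fun p : C3C3 => weightedSum A p.1 i) nonzeroPairs := fun i =>
    (contDiff_pi.1 ((contDiff_weightedSum A).comp contDiff_fst) i).contDiffOn
  have hY : ∀ i, ContDiffOn ℝ ∞ (fun p : C3C3 => weightedSum B p.2 i) nonzeroPairs := fun i =>
    (contDiff_pi.1 ((contDiff_weightedSum B).comp contDiff_snd) i).contDiffOn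
  have hd : ContDiffOn ℝ ∞
      (fun p : C3C3 => area (weightedSum A p.1) (weightedSum B p.2)) nonzeroPairs :=
    ((hX 0).mul (hY 1)).sub ((hX 1).mul (hY 0))
  have hs : ContDiffOn ℝ ∞ (scaleSqFst A B C) nonzeroPairs :=
    ((contDiffOn_const.mul (hY 1)).sub (contDiffOn_const.mul (hY 0))).div hd
      fun p hp => h.area_ne_zero hp
  have ht : ContDiffOn ℝ ∞ (scaleSqSnd A B C) nonzeroPairs :=
    (((hX 0).mul contDiffOn_const).sub ((hX 1).mul contDiffOn_const)).div hd
      fun p hp => h.area_ne_zero hp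
  exact ((hs.sqrt fun p hp => (h.scaleSqFst_pos hp).ne').smul contDiffOn_fst).prodMk
    ((ht.sqrt fun p hp => (h.scaleSqSnd_pos hp).ne').smul contDiffOn_snd)

theorem rescale_mem_levelSet (h : CommonSign A B C) (hp : p ∈ quadricM) :
    rescale A B C p ∈ levelSet A B C := by
  have hp' : p ∈ nonzeroPairs := ⟨hp.1, hp.2.1⟩
  have hs := h.scaleSqFst_pos hp'
  have ht := h.scaleSqSnd_pos hp'
  refine ⟨smul_mem_quadricM hp (Real.sqrt_pos.2 hs).ne' (Real.sqrt_pos.2 ht).ne', ?_⟩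
  rw [rescale, momentPhi_smul, Real.sq_sqrt hs.le, Real.sq_sqrt ht.le]
  exact cramer_plane (h.area_ne_zero hp') C

/-- The level set meets each orbit of positive rescalings only once. -/
theorem rescale_smul_eq (h : CommonSign A B C) (hp : p ∈ levelSet A B C) {s t : ℝ}
    (hs : 0 < s) (ht : 0 < t) : rescale A B C (s • p.1, t • p.2) = p := by
  have hd := h.area_ne_zero (levelSet_subset_nonzeroPairs A B C hp)
  have hC : C = weightedSum A p.1 + weightedSum B p.2 := by rw [← momentPhi_eq, hp.2]
  have h1 : scaleSqFst A B C (s • p.1, t • p.2) = s⁻¹ ^ 2 := by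
    simp only [scaleSqFst, weightedSum_smul]
    have e1 : area C (t ^ 2 • weightedSum B p.2)
        = t ^ 2 * area (weightedSum A p.1) (weightedSum B p.2) := by
      simp [hC, area]; ring
    have e2 : area (s ^ 2 • weightedSum A p.1) (t ^ 2 • weightedSum B p.2)
        = s ^ 2 * t ^ 2 * area (weightedSum A p.1) (weightedSum B p.2) := by
      simp [area]; ring
    rw [e1, e2]
    field_simp
  have h2 : scaleSqSnd A B C (s • p.1, t • p.2) = t⁻¹ ^ 2 := by
    simp only [scaleSqSnd, weightedSum_smul]
    have e1 : area (s ^ 2 • weightedSum A p.1) C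
        = s ^ 2 * area (weightedSum A p.1) (weightedSum B p.2) := by
      simp [hC, area]; ring
    have e2 : area (s ^ 2 • weightedSum A p.1) (t ^ 2 • weightedSum B p.2)
        = s ^ 2 * t ^ 2 * area (weightedSum A p.1) (weightedSum B p.2) := by
      simp [area]; ring
    rw [e1, e2]
    field_simp
  rw [rescale, h1, h2, Real.sqrt_sq (inv_pos.2 hs).le, Real.sqrt_sq (inv_pos.2 ht).le]
  exact Prod.ext (inv_smul_smul₀ hs.ne' _) (inv_smul_smul₀ ht.ne' _)

theorem rescale_rescale (h : CommonSign A B C) {A' B' : Fin 3 → Fin 2 → ℝ} {C' : Fin 2 → ℝ}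
    (h' : CommonSign A' B' C') (hp : p ∈ levelSet A B C) :
    rescale A B C (rescale A' B' C' p) = p :=
  have hp' := levelSet_subset_nonzeroPairs A B C hp
  h.rescale_smul_eq hp (Real.sqrt_pos.2 (h'.scaleSqFst_pos hp'))
    (Real.sqrt_pos.2 (h'.scaleSqSnd_pos hp'))

end CommonSign

/-! ### Regularity -/

theorem contDiff_quadric : ContDiff ℝ ∞ quadric := by
  unfold quadric
  exact ContDiff.sum fun j _ =>
    ((contDiff_apply ℝ ℂ j).comp contDiff_fst).mul ((contDiff_apply ℝ ℂ j).comp contDiff_snd)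

theorem contDiff_momentPhi (A B : Fin 3 → Fin 2 → ℝ) : ContDiff ℝ ∞ (momentPhi A B) := by
  rw [funext (momentPhi_eq A B)]
  exact ((contDiff_weightedSum A).comp contDiff_fst).add
    ((contDiff_weightedSum B).comp contDiff_snd)

theorem add_smul_smul_eq (p : C3C3) (s t r : ℝ) :
    p + r • ((s • p.1, t • p.2) : C3C3) = ((1 + r * s) • p.1, (1 + r * t) • p.2) :=
  Prod.ext (by simp [add_smul, mul_smul]) (by simp [add_smul, mul_smul])

theorem fderiv_quadric_smul {p : C3C3} (hp : quadric p = 0) (s t : ℝ) :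
    fderiv ℝ quadric p (s • p.1, t • p.2) = 0 := by
  rw [← (contDiff_quadric.differentiable (by simp) p).lineDeriv_eq_fderiv, lineDeriv]
  simp only [add_smul_smul_eq, quadric_smul, hp, mul_zero, deriv_const]

theorem fderiv_momentPhi_smul (A B : Fin 3 → Fin 2 → ℝ) (p : C3C3) (s t : ℝ) :
    fderiv ℝ (momentPhi A B) p (s • p.1, t • p.2)
      = (2 * s) • weightedSum A p.1 + (2 * t) • weightedSum B p.2 := by
  rw [← ((contDiff_momentPhi A B).differentiable (by simp) p).lineDeriv_eq_fderiv, lineDeriv]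
  simp only [add_smul_smul_eq, momentPhi_smul]
  have hd : ∀ s : ℝ, HasDerivAt (fun r : ℝ => (1 + r * s) ^ 2) (2 * s) 0 := fun s => by
    simpa using (((hasDerivAt_id' (0 : ℝ)).mul_const s).const_add 1).fun_pow 2
  exact (((hd s).smul_const _).add ((hd t).smul_const _)).deriv

theorem CommonSign.isRegularValuePhi {A B : Fin 3 → Fin 2 → ℝ} {C : Fin 2 → ℝ}
    (h : CommonSign A B C) : IsRegularValuePhi A B C := by
  intro p hp c
  have hd := h.area_ne_zero (levelSet_subset_nonzeroPairs A B C hp)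
  -- `c` is an arbitrary vector here, so these Cramer quotients may have any sign; the factor `1/2`
  -- cancels the `2` in the derivative of a square.
  refine ⟨((scaleSqFst A B c p / 2) • p.1, (scaleSqSnd A B c p / 2) • p.2),
    fderiv_quadric_smul hp.1.2.2 _ _, ?_⟩
  rw [fderiv_momentPhi_smul, mul_div_cancel₀ _ two_ne_zero, mul_div_cancel₀ _ two_ne_zero]
  exact cramer_plane hd c

/-! ### Equivariance -/

theorem smul_fst_apply (t : Torus × Torus) (p : C3C3) (j : Fin 3) :
    (t • p).1 j = (((t.1 : Fin 3 → Circle) j : ℂ) * ((t.2 : Fin 3 → Circle) 0 : ℂ)⁻¹) * p.1 j :=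
  rfl

theorem smul_snd_apply (t : Torus × Torus) (p : C3C3) (j : Fin 3) :
    (t • p).2 j = (((t.1 : Fin 3 → Circle) j : ℂ)⁻¹ * ((t.2 : Fin 3 → Circle) 2 : ℂ)) * p.2 j :=
  rfl

theorem norm_smul_fst (t : Torus × Torus) (p : C3C3) (j : Fin 3) : ‖(t • p).1 j‖ = ‖p.1 j‖ := by
  simp [smul_fst_apply, Circle.norm_coe]

theorem norm_smul_snd (t : Torus × Torus) (p : C3C3) (j : Fin 3) : ‖(t • p).2 j‖ = ‖p.2 j‖ := by
  simp [smul_snd_apply, Circle.norm_coe]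

theorem weightedSum_smul_fst (A : Fin 3 → Fin 2 → ℝ) (t : Torus × Torus) (p : C3C3) :
    weightedSum A (t • p).1 = weightedSum A p.1 := by
  simp only [weightedSum, norm_smul_fst]

theorem weightedSum_smul_snd (B : Fin 3 → Fin 2 → ℝ) (t : Torus × Torus) (p : C3C3) :
    weightedSum B (t • p).2 = weightedSum B p.2 := by
  simp only [weightedSum, norm_smul_snd]

theorem quadric_torus_smul (t : Torus × Torus) (p : C3C3) :
    quadric (t • p)
      = ((t.2 : Fin 3 → Circle) 0 : ℂ)⁻¹ * ((t.2 : Fin 3 → Circle) 2 : ℂ) * quadric p := by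
  simp only [quadric, smul_fst_apply, smul_snd_apply, Finset.mul_sum]
  refine Finset.sum_congr rfl fun j _ => ?_
  have := Circle.coe_ne_zero ((t.1 : Fin 3 → Circle) j)
  field_simp

theorem smul_mem_levelSet {A B : Fin 3 → Fin 2 → ℝ} {C : Fin 2 → ℝ} (t : Torus × Torus)
    {p : C3C3} (hp : p ∈ levelSet A B C) : t • p ∈ levelSet A B C := by
  obtain ⟨⟨hz, hw, hq⟩, hC⟩ := hp
  refine ⟨⟨fun h => hz (funext fun j => ?_), fun h => hw (funext fun j => ?_), ?_⟩, ?_⟩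
  · rw [Pi.zero_apply, ← norm_eq_zero, ← norm_smul_fst t, h, Pi.zero_apply, norm_zero]
  · rw [Pi.zero_apply, ← norm_eq_zero, ← norm_smul_snd t, h, Pi.zero_apply, norm_zero]
  · rw [quadric_torus_smul, hq, mul_zero]
  · rw [momentPhi_eq, weightedSum_smul_fst, weightedSum_smul_snd, ← momentPhi_eq, hC]

theorem rescale_torus_smul (A B : Fin 3 → Fin 2 → ℝ) (C : Fin 2 → ℝ) (t : Torus × Torus)
    (p : C3C3) : rescale A B C (t • p) = t • rescale A B C p := by
  have h1 : scaleSqFst A B C (t • p) = scaleSqFst A B C p := by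
    simp only [scaleSqFst, weightedSum_smul_fst, weightedSum_smul_snd]
  have h2 : scaleSqSnd A B C (t • p) = scaleSqSnd A B C p := by
    simp only [scaleSqSnd, weightedSum_smul_fst, weightedSum_smul_snd]
  refine Prod.ext (funext fun j => ?_) (funext fun j => ?_)
  · simp only [rescale, h1, smul_fst_apply, Pi.smul_apply, mul_smul_comm]
  · simp only [rescale, h2, smul_snd_apply, Pi.smul_apply, mul_smul_comm]

/-! ### The standard level set and `SU(3)` -/

/-- The level set `{|z| = |w| = 1, ∑ z_j w_j = 0}` of `(|z|², |w|²)` over `(1, 1)`. -/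
abbrev stdLevelSet : Set C3C3 := levelSet (fun _ => ![1, 0]) (fun _ => ![0, 1]) ![1, 1]

theorem commonSign_std : CommonSign (fun _ => ![1, 0]) (fun _ => ![0, 1]) ![1, 1] :=
  ⟨1, by simp [area], by simp [area], by simp [area]⟩

theorem mem_stdLevelSet_iff {p : C3C3} : p ∈ stdLevelSet ↔
    (∑ j, p.1 j * conj (p.1 j) = 1 ∧ ∑ j, p.2 j * conj (p.2 j) = 1) ∧ quadric p = 0 := by
  have hnorm : ∀ z : Fin 3 → ℂ,
      ∑ j, z j * conj (z j) = 1 ↔ ∑ j, ‖z j‖ ^ 2 = 1 := fun z => by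
    simp only [Complex.mul_conj, Complex.normSq_eq_norm_sq]
    exact_mod_cast Iff.rfl
  have hphi : momentPhi (fun _ => ![1, 0]) (fun _ => ![0, 1]) p = ![1, 1] ↔
      ∑ j, ‖p.1 j‖ ^ 2 = 1 ∧ ∑ j, ‖p.2 j‖ ^ 2 = 1 := by
    rw [funext_iff, Fin.forall_fin_two]
    simp [momentPhi, Finset.sum_apply]
  rw [hnorm, hnorm, ← hphi]
  refine ⟨fun h => ⟨h.2, h.1.2.2⟩, fun h => ⟨⟨fun h0 => ?_, fun h0 => ?_, h.2⟩, h.1⟩⟩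
  · simpa [h0] using (hphi.1 h.1).1
  · simpa [h0] using (hphi.1 h.1).2

/-- The matrix with first column `z`, third column `conj w`, and second column the conjugate of the
cross product of the third column with the first. -/
noncomputable def frameMatrix (p : C3C3) : Matrix (Fin 3) (Fin 3) ℂ :=
  Matrix.of fun i => ![p.1 i, p.2 (i + 1) * conj (p.1 (i + 2)) - p.2 (i + 2) * conj (p.1 (i + 1)),
    conj (p.2 i)]

/-- The first column and the conjugate of the third column of a matrix. -/
noncomputable def outerColumns (S : Matrix (Fin 3) (Fin 3) ℂ) : C3C3 :=
  (fun j => S j 0, fun j => conj (S j 2))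

theorem outerColumns_frameMatrix (p : C3C3) : outerColumns (frameMatrix p) = p :=
  Prod.ext (funext fun j => by simp [outerColumns, frameMatrix])
    (funext fun j => by simp [outerColumns, frameMatrix])

theorem frameMatrix_mem_SU3 {p : C3C3} (hp : p ∈ stdLevelSet) : frameMatrix p ∈ SU3 := by
  obtain ⟨⟨hz, hw⟩, hq⟩ := mem_stdLevelSet_iff.1 hp
  have hq' := congrArg conj hq
  simp only [quadric, Fin.sum_univ_three, map_add, map_mul, map_zero] at hz hw hq hq'
  have e3 : (1 + 2 : Fin 3) = 0 := rfl
  have e4 : (2 + 1 : Fin 3) = 0 := rfl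
  have e5 : (2 + 2 : Fin 3) = 1 := rfl
  have e6 : (1 + 1 : Fin 3) = 2 := rfl
  refine Matrix.mem_specialUnitaryGroup_iff.2 ⟨Matrix.mem_unitaryGroup_iff'.2 ?_, ?_⟩
  · ext i j
    rw [Matrix.mul_apply, Fin.sum_univ_three]
    fin_cases i <;> fin_cases j <;>
      simp [frameMatrix, e3, e4, e5, e6]
    · linear_combination hz
    · ring
    · linear_combination hq'
    · ring
    · linear_combination (p.2 0 * conj (p.2 0) + p.2 1 * conj (p.2 1) + p.2 2 * conj (p.2 2)) * hz
        + hw - (conj (p.1 0) * conj (p.2 0) + conj (p.1 1) * conj (p.2 1)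
          + conj (p.1 2) * conj (p.2 2)) * hq
    · ring
    · linear_combination hq
    · ring
    · linear_combination hw
  · rw [Matrix.det_fin_three]
    simp [frameMatrix, e3, e4, e5, e6]
    linear_combination (p.2 0 * conj (p.2 0) + p.2 1 * conj (p.2 1) + p.2 2 * conj (p.2 2)) * hz
        + hw - (conj (p.1 0) * conj (p.2 0) + conj (p.1 1) * conj (p.2 1)
          + conj (p.1 2) * conj (p.2 2)) * hq

theorem outerColumns_mem_stdLevelSet {S : Matrix (Fin 3) (Fin 3) ℂ} (hS : S ∈ SU3) :
    outerColumns S ∈ stdLevelSet := by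
  have h := Matrix.mem_unitaryGroup_iff'.1 (Matrix.mem_specialUnitaryGroup_iff.1 hS).1
  have h00 := congrFun (congrFun h 0) 0
  have h22 := congrFun (congrFun h 2) 2
  have h20 := congrFun (congrFun h 2) 0
  simp [Matrix.mul_apply, Fin.sum_univ_three] at h00 h22 h20
  refine mem_stdLevelSet_iff.2 ⟨⟨?_, ?_⟩, ?_⟩ <;>
    simp [outerColumns, quadric, Fin.sum_univ_three]
  · linear_combination h00
  · linear_combination h22
  · linear_combination h20

/-- The second column of `S ∈ SU(3)` is determined by the others, because the inverse `Sᴴ` of `S`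
is its adjugate. -/
theorem frameMatrix_outerColumns {S : Matrix (Fin 3) (Fin 3) ℂ} (hS : S ∈ SU3) :
    frameMatrix (outerColumns S) = S := by
  obtain ⟨hU, hdet⟩ := Matrix.mem_specialUnitaryGroup_iff.1 hS
  have hadj : Matrix.adjugate S = star S := by
    calc Matrix.adjugate S = star S * S * Matrix.adjugate S := by
          rw [Matrix.mem_unitaryGroup_iff'.1 hU, one_mul]
      _ = star S := by rw [mul_assoc, Matrix.mul_adjugate, hdet, one_smul, mul_one]
  have hcol : ∀ i, S i 1 = conj (Matrix.adjugate S 1 i) := fun i => by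
    rw [hadj, Matrix.star_apply, ← starRingEnd_apply, Complex.conj_conj]
  rw [Matrix.adjugate_fin_three] at hcol
  ext i j
  fin_cases j
  · rfl
  · simp only [Fin.mk_one]
    rw [hcol]
    fin_cases i <;> simp [frameMatrix, outerColumns] <;> ring
  · simp [frameMatrix, outerColumns]

theorem outerColumns_smul (t : Torus × Torus) (S : Matrix (Fin 3) (Fin 3) ℂ) :
    outerColumns (t • S) = t • outerColumns S := by
  have h : ∀ i j, (t • S) i j = ((t.1 : Fin 3 → Circle) i : ℂ) * S i j
      * ((t.2 : Fin 3 → Circle) j : ℂ)⁻¹ := fun i j => by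
    change (torusMatrix t.1 * S * torusMatrix (t.2⁻¹)) i j = _
    simp [torusMatrix, Matrix.mul_diagonal, Matrix.diagonal_mul]
  refine Prod.ext (funext fun j => ?_) (funext fun j => ?_)
  · simp only [outerColumns, smul_fst_apply, h]
    ring
  · simp only [outerColumns, smul_snd_apply, h, map_mul, map_inv₀, ← Circle.coe_inv_eq_conj]
    simp
    ring

theorem torus_smul_mem_SU3 (t : Torus × Torus) {S : Matrix (Fin 3) (Fin 3) ℂ} (hS : S ∈ SU3) :
    t • S ∈ SU3 :=
  mul_mem (mul_mem (torusMatrix_mem t.1) hS) (torusMatrix_mem t.2⁻¹)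

theorem frameMatrix_smul (t : Torus × Torus) {p : C3C3} (hp : p ∈ stdLevelSet) :
    frameMatrix (t • p) = t • frameMatrix p := by
  rw [← frameMatrix_outerColumns (torus_smul_mem_SU3 t (frameMatrix_mem_SU3 hp)),
    outerColumns_smul, outerColumns_frameMatrix]

theorem contDiff_frameMatrix : ContDiff ℝ ∞ frameMatrix := by
  have hz : ∀ i, ContDiff ℝ ∞ fun p : C3C3 => p.1 i := fun i =>
    (contDiff_apply ℝ ℂ i).comp contDiff_fst
  have hw : ∀ i, ContDiff ℝ ∞ fun p : C3C3 => p.2 i := fun i =>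
    (contDiff_apply ℝ ℂ i).comp contDiff_snd
  have hc : ∀ {f : C3C3 → ℂ}, ContDiff ℝ ∞ f → ContDiff ℝ ∞ fun p => conj (f p) := fun hf =>
    Complex.conjCLE.contDiff.comp hf
  refine contDiff_pi.2 fun i => contDiff_pi.2 fun j => ?_
  fin_cases j
  · exact hz i
  · exact ((hw _).mul (hc (hz _))).sub ((hw _).mul (hc (hz _)))
  · exact hc (hw i)

theorem contDiff_outerColumns : ContDiff ℝ ∞ outerColumns := by
  have hS : ∀ i j, ContDiff ℝ ∞ fun S : Matrix (Fin 3) (Fin 3) ℂ => S i j := fun i j =>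
    (contDiff_apply ℝ ℂ j).comp (contDiff_apply ℝ (Fin 3 → ℂ) i)
  exact (contDiff_pi.2 fun i => hS i 0).prodMk
    (contDiff_pi.2 fun i => Complex.conjCLE.contDiff.comp (hS i 2))

/-! ### The equivariant diffeomorphism -/

/-- Smooth equivariant maps of open neighbourhoods that restrict to mutually inverse maps between
`X` and `Y` give an equivariant diffeomorphism. -/
theorem EquivariantlyDiffeomorphic.of_contDiffOn {G : Type*} [Group G] {E F : Type*}
    [NormedAddCommGroup E] [NormedSpace ℝ E] [NormedAddCommGroup F] [NormedSpace ℝ F]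
    [MulAction G E] [MulAction G F] {X U : Set E} {Y V : Set F} {φ : E → F} {ψ : F → E}
    (hX : ∀ (g : G), ∀ x ∈ X, g • x ∈ X) (hU : IsOpen U) (hXU : X ⊆ U) (hV : IsOpen V)
    (hYV : Y ⊆ V) (hφ : ContDiffOn ℝ ∞ φ U) (hψ : ContDiffOn ℝ ∞ ψ V) (hφm : Set.MapsTo φ X Y)
    (hψm : Set.MapsTo ψ Y X) (hl : Set.LeftInvOn ψ φ X) (hr : Set.RightInvOn ψ φ Y)
    (he : ∀ (g : G), ∀ x ∈ X, φ (g • x) = g • φ x) : EquivariantlyDiffeomorphic G X Y :=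
  ⟨hX, ⟨fun x => ⟨φ x, hφm x.2⟩, fun y => ⟨ψ y, hψm y.2⟩, fun x => Subtype.ext (hl x.2),
    fun y => Subtype.ext (hr y.2)⟩, fun x => ⟨U, φ, hU, hXU x.2, hφ, fun _ _ => rfl⟩,
    fun y => ⟨V, ψ, hV, hYV y.2, hψ, fun _ _ => rfl⟩, fun g x => he g x x.2⟩

/-- The diffeomorphism is the rescaling to the standard level set followed by `frameMatrix`; its
inverse is `outerColumns` followed by the rescaling back. -/
theorem CommonSign.equivariantlyDiffeomorphic_SU3 {A B : Fin 3 → Fin 2 → ℝ} {C : Fin 2 → ℝ}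
    (h : CommonSign A B C) : EquivariantlyDiffeomorphic (Torus × Torus) (levelSet A B C) SU3 := by
  have hmem : ∀ S ∈ SU3, outerColumns S ∈ nonzeroPairs := fun S hS =>
    levelSet_subset_nonzeroPairs _ _ _ (outerColumns_mem_stdLevelSet hS)
  refine EquivariantlyDiffeomorphic.of_contDiffOn
    (φ := fun p => frameMatrix (rescale (fun _ => ![1, 0]) (fun _ => ![0, 1]) ![1, 1] p))
    (ψ := fun S => rescale A B C (outerColumns S))
    (V := outerColumns ⁻¹' nonzeroPairs)
    (fun t _ hp => smul_mem_levelSet t hp) isOpen_nonzeroPairs (levelSet_subset_nonzeroPairs A B C)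
    (isOpen_nonzeroPairs.preimage contDiff_outerColumns.continuous) hmem
    (contDiff_frameMatrix.comp_contDiffOn commonSign_std.contDiffOn_rescale)
    (h.contDiffOn_rescale.comp contDiff_outerColumns.contDiffOn fun _ hS => hS)
    (fun p hp => frameMatrix_mem_SU3 (commonSign_std.rescale_mem_levelSet hp.1))
    (fun S hS => h.rescale_mem_levelSet (outerColumns_mem_stdLevelSet hS).1)
    (fun p hp => ?_) (fun S hS => ?_) (fun t p hp => ?_)
  · simp only [outerColumns_frameMatrix]
    exact h.rescale_rescale commonSign_std hp
  · simp only [commonSign_std.rescale_rescale h (outerColumns_mem_stdLevelSet hS),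
      frameMatrix_outerColumns hS]
  · simp only [rescale_torus_smul]
    exact frameMatrix_smul t (commonSign_std.rescale_mem_levelSet hp.1)

theorem theorem4p5 (A B : Fin 3 → Fin 2 → ℝ) (C : Fin 2 → ℝ)
    (hAB : A 0 + B 0 = A 1 + B 1 ∧ A 1 + B 1 = A 2 + B 2)
    (hstar : StarCondition A B C) :
    IsRegularValuePhi A B C ∧
      EquivariantlyDiffeomorphic (Torus × Torus) (levelSet A B C) SU3 :=
  ⟨hstar.commonSign.isRegularValuePhi, hstar.commonSign.equivariantlyDiffeomorphic_SU3⟩
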